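/- Let $\mathcal C$ be a small category with a monoidal structure $(\otimes, I)$ and a Grothendieck topology $J$. For presheaves $F,G$ let $F\circledast G=\mathrm{Lan}_{\otimes}(F\boxtimes G)$ be the Day convolution, with universal maps $F(A)\times G(B)\to (F\circledast G)(A\otimes B)$, $(x,y)\mapsto x\otimes y$. Assume that $(\mathcal C,\otimes,J)$ is *Day-stable*: the Day convolution of two sheaves is a sheaf, and $\circledast$ preserves monomorphisms of sheaves in both arguments. For a small sheaf $X$ let $\mathrm{Pred}_X$ be the following internal category in $\mathrm{Sh}(\mathcal C,J)$ (the fibre over $X$ of the predicate fibration). The elements of the sheaf $\mathrm{Pred}_{X,0}(A)$ are the subsheaves $P$ of the restriction of $X$ to $\mathcal C/A$; for $p\colon B\to A$ and $x\in X(B)$ we say that $x$ *satisfies $P$ at $p$* if $x\in P(p)$. The elements of $\mathrm{Pred}_{X,1}(A)$ are the pairs $P\le Q$ of elements of $\mathrm{Pred}_{X,0}(A)$. Restriction is along $\mathcal C/B\to\mathcal C/A$. For a morphism $f\colon X\to Y$ of sheaves, $f^*$ is the preimage of predicates. An *existential quantification* along $f$ is an internal functor $\exists^f\colon \mathrm{Pred}_X\to\mathrm{Pred}_Y$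 whose object part $\exists^f_0$ satisfies $\exists^f_0P\le Q\iff P\le f^*Q$ at every stage $A$. Let $M(F)$ be the matching-object sheaf of $F$: the elements of $M(F)(A)$ are the matching families of $F$ on covering sieves of $A$, two of them being identified if they agree on a common refinement. **Theorem.** Let $F$ be a small sheaf with the structure of a monoid for Day convolution, with multiplication $\odot\colon F\circledast F\to F$. 1. There is a unique map $a\colon M(F)\to F$ that sends every matching family to its amalgamation, and it is an isomorphism. Put $\odot'=a^{-1}\circ\odot\colon F\circledast F\to M(F)$. 2. Among the families of maps $\mathrm{Pred}_{F,0}(A)\times\mathrm{Pred}_{F,0}(B)\to\mathrm{Pred}_{F\circledast F,0}(A\otimes B)$, natural in $A$ and $B$, with the property that $x\otimes y$ satisfies the value at $(P,Q)$ at $p\otimes q$ whenever $x$ satisfies $P$ at $p$ and $y$ satisfies $Q$ at $q$, there is a least one, $\beta$. By the universal property of the left Kan extension there is a unique map of sheaves $\alpha\colon \mathrm{Pred}_{F,0}\circledast\mathrm{Pred}_{F,0}\to\mathrm{Pred}_{F\circledast F,0}$ with $\alpha(P\otimes Q)=\beta(P,Q)$. 3. There are a unique existential quantification $\exists^{\odot'}\colon\mathrm{Pred}_{F\circledast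 F}\to\mathrm{Pred}_{M(F)}$ along $\odot'$ and a unique existential quantification $\exists^{a}\colon\mathrm{Pred}_{M(F)}\to\mathrm{Pred}_F$ along $a$. 4. Consequently there are the induced maps of sheaves $$\exists^\odot_0:=\exists^{\odot'}_0\circ\alpha\colon\ \mathrm{Pred}_{F,0}\circledast\mathrm{Pred}_{F,0}\to\mathrm{Pred}_{M(F),0},\qquad \star:=\exists^{a}_0\circ\exists^\odot_0\colon\ \mathrm{Pred}_{F,0}\circledast\mathrm{Pred}_{F,0}\to\mathrm{Pred}_{F,0}$$ (the latter is the separating conjunction). Explicitly, let $z\in(\mathrm{Pred}_{F,0}\circledast\mathrm{Pred}_{F,0})(Z)$ and $r\colon V\to Z$. An element $m\in F(V)$ satisfies $\star(z)$ at $r$ if and only if there is a covering sieve $S$ of $V$ such that for every $g\colon W\to V$ in $S$ there are $f\colon W\to A\otimes B$, predicates $P\in\mathrm{Pred}_{F,0}(A)$, $Q\in\mathrm{Pred}_{F,0}(B)$ and elements $x\in F(A)$, $y\in F(B)$ satisfying $P$ and $Q$ at the identities such that $z|_{r\circ g}=(P\otimes Q)|_f$ and $\odot\big((x\otimes y)|_f\big)=m|_g$.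 The same formula holds for $\exists^\odot_0(z)$ and $m\in M(F)(V)$, with $\odot'$ in place of $\odot$. -/

import Mathlib

open CategoryTheory MonoidalCategory Opposite Limits
open scoped MonoidalCategory.ExternalProduct MonoidalCategory.DayFunctor

universe u

namespace Sheafeology

section InternalCategories

universe v w

/-- A category internal to a category `E` with pullbacks. -/
structure InternalCat (E : Type w) [Category.{v} E] [HasPullbacks E] where
  ob : E
  mor : E
  s : mor ⟶ ob
  t : mor ⟶ ob
  e : ob ⟶ mor
  /-- Composition; a generalised element of the pullback is a pair `(g, f)` with `s g = t f`. -/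
  c : pullback s t ⟶ mor
  e_s : e ≫ s = 𝟙 ob
  e_t : e ≫ t = 𝟙 ob
  c_s : c ≫ s = pullback.snd s t ≫ s
  c_t : c ≫ t = pullback.fst s t ≫ t
  comp_id : pullback.lift (𝟙 mor) (s ≫ e)
    (by rw [Category.id_comp, Category.assoc, e_t, Category.comp_id]) ≫ c = 𝟙 mor
  id_comp : pullback.lift (t ≫ e) (𝟙 mor)
    (by rw [Category.id_comp, Category.assoc, e_s, Category.comp_id]) ≫ c = 𝟙 mor
  /-- Associativity, on generalised elements. -/
  assoc : ∀ {T : E} (h g f : T ⟶ mor) (hg : h ≫ s = g ≫ t) (gf : g ≫ s = f ≫ t),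
    pullback.lift h (pullback.lift g f gf ≫ c)
        (by rw [Category.assoc, c_t, pullback.lift_fst_assoc, hg]) ≫ c =
      pullback.lift (pullback.lift h g hg ≫ c) f
        (by rw [Category.assoc, c_s, pullback.lift_snd_assoc, gf]) ≫ c

/-- A functor between internal categories. -/
structure InternalFunctor {E : Type w} [Category.{v} E] [HasPullbacks E]
    (A B : InternalCat E) where
  onOb : A.ob ⟶ B.ob
  onMor : A.mor ⟶ B.mor
  map_s : onMor ≫ B.s = A.s ≫ onOb
  map_t : onMor ≫ B.t = A.t ≫ onOb
  map_e : A.e ≫ onMor = onOb ≫ B.e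
  map_c : A.c ≫ onMor =
    pullback.lift (pullback.fst A.s A.t ≫ onMor) (pullback.snd A.s A.t ≫ onMor)
      (by rw [Category.assoc, Category.assoc, map_s, map_t, pullback.condition_assoc]) ≫ B.c

end InternalCategories

section SubSheaves

variable {D : Type u} [SmallCategory D]

/-- A subsheaf of `S` for the topology `K`. -/
@[ext]
structure SubSheaf (K : GrothendieckTopology D) (S : Dᵒᵖ ⥤ Type u) extends Subfunctor S where
  isSheaf : Presieve.IsSheaf K toSubfunctor.toFunctor

variable {K : GrothendieckTopology D} {S S' : Dᵒᵖ ⥤ Type u}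

theorem SubSheaf.toSubfunctor_injective :
    Function.Injective (SubSheaf.toSubfunctor : SubSheaf K S → Subfunctor S) := by
  rintro ⟨P, hP⟩ ⟨Q, hQ⟩ h
  cases h
  rfl

instance : PartialOrder (SubSheaf K S) :=
  PartialOrder.lift SubSheaf.toSubfunctor SubSheaf.toSubfunctor_injective

/-- The preimage of a subsheaf along a morphism of sheaves. -/
def SubSheaf.preimage (hS : Presieve.IsSheaf K S) (hS' : Presieve.IsSheaf K S')
    (γ : S ⟶ S') (Q : SubSheaf K S') : SubSheaf K S where
  toSubfunctor := Q.toSubfunctor.preimage γ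
  isSheaf := by
    rw [Subfunctor.isSheaf_iff _ hS]
    intro U s hs
    refine (Subfunctor.isSheaf_iff _ hS').1 Q.isSheaf U _ ?_
    refine K.superset_covering ?_ hs
    intro V f hf
    have : γ.app _ (S.map f.op s) ∈ Q.obj (op V) := hf
    rwa [NatTrans.naturality_apply] at this

end SubSheaves

variable {C : Type u} [SmallCategory C] {J : GrothendieckTopology C}


/-- Restriction of a subsheaf along a continuous functor. -/
def SubSheaf.res {D D' : Type u} [SmallCategory D] [SmallCategory D'] (G : D' ⥤ D)
    (K' : GrothendieckTopology D') {K : GrothendieckTopology D} [G.IsContinuous K' K]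
    {S : Dᵒᵖ ⥤ Type u} (P : SubSheaf K S) : SubSheaf K' (G.op ⋙ S) where
  obj p := P.obj (G.op.obj p)
  map i := P.map (G.op.map i)
  isSheaf := G.op_comp_isSheaf_of_types K' K
    ⟨P.toFunctor, (isSheaf_iff_isSheaf_of_type _ _).2 P.isSheaf⟩

/-- Restriction of a subsheaf of a sheaf on `C/A` along `C/B ⥤ C/A`, for `a : B ⟶ A`. -/
def SubSheaf.over {A B : C} (a : B ⟶ A) {S : (Over A)ᵒᵖ ⥤ Type u} (P : SubSheaf (J.over A) S) :
    SubSheaf (J.over B) ((Over.map a).op ⋙ S) :=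
  P.res (Over.map a) (J.over B)

theorem isSheaf_res (X : Sheaf J (Type u)) (A : C) :
    Presieve.IsSheaf (J.over A) ((Over.forget A).op ⋙ X.obj) :=
  (Over.forget A).op_comp_isSheaf_of_types (J.over A) J X

/-- The predicates on `X` at stage `A`: the subsheaves of the restriction of `X` to `C/A`, that is,
the maps from it to the subobject classifier. They form the fibre over `X` of the predicate
fibration, see `isPullback_fibreOb` below. -/
abbrev LocalPred (X : Sheaf J (Type u)) (A : C) : Type u :=
  SubSheaf (J.over A) ((Over.forget A).op ⋙ X.obj)

namespace LocalPred

variable {X Y : Sheaf J (Type u)} {A B : C}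

/-- `P.Holds p x`: the element `x` of `X(B)` satisfies the predicate `P` at `p : B ⟶ A`. -/
def Holds (P : LocalPred X A) (p : B ⟶ A) (x : X.obj.obj (op B)) : Prop :=
  x ∈ P.obj (op (Over.mk p))

theorem ext_holds {P Q : LocalPred X A}
    (h : ∀ {B : C} (p : B ⟶ A) (x : X.obj.obj (op B)), P.Holds p x ↔ Q.Holds p x) : P = Q := by
  apply SubSheaf.ext
  funext U
  ext x
  exact h U.unop.hom x

theorem le_iff {P Q : LocalPred X A} : P ≤ Q ↔
    ∀ {B : C} (p : B ⟶ A) (x : X.obj.obj (op B)), P.Holds p x → Q.Holds p x :=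
  ⟨fun h _ p x hx => h (op (Over.mk p)) hx, fun h U x hx => h U.unop.hom x hx⟩

theorem Holds.map {P : LocalPred X A} {p : B ⟶ A} {x : X.obj.obj (op B)} (h : P.Holds p x)
    {V : C} (g : V ⟶ B) : P.Holds (g ≫ p) (X.obj.map g.op x) :=
  P.map (Over.homMk g : Over.mk (g ≫ p) ⟶ Over.mk p).op h

theorem holds_of_cover (P : LocalPred X A) (p : B ⟶ A) (x : X.obj.obj (op B))
    (S : Sieve B) (hS : S ∈ J B)
    (h : ∀ {V : C} (g : V ⟶ B), S g → P.Holds (g ≫ p) (X.obj.map g.op x)) : P.Holds p x := by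
  refine (Subfunctor.isSheaf_iff _ (isSheaf_res X A)).1 P.isSheaf _ _ ?_
  rw [GrothendieckTopology.mem_over_iff]
  refine J.superset_covering ?_ hS
  intro V g hg
  exact (Sieve.overEquiv_iff _ _).2 (h g hg)

/-- A restriction-stable, local family of subsets is a local predicate. -/
def mk' (X : Sheaf J (Type u)) (A : C)
    (H : ∀ {B : C}, (B ⟶ A) → X.obj.obj (op B) → Prop)
    (hmap : ∀ {B V : C} (g : V ⟶ B) (p : B ⟶ A) (x : X.obj.obj (op B)), H p x →
      H (g ≫ p) (X.obj.map g.op x))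
    (hloc : ∀ {B : C} (p : B ⟶ A) (x : X.obj.obj (op B)) (S : Sieve B), S ∈ J B →
      (∀ {V : C} (g : V ⟶ B), S g → H (g ≫ p) (X.obj.map g.op x)) → H p x) :
    LocalPred X A where
  obj U := {x | H U.unop.hom x}
  map {U V} i x hx := by
    have := hmap i.unop.left U.unop.hom x hx
    rw [Over.w] at this
    exact this
  isSheaf := by
    rw [Subfunctor.isSheaf_iff _ (isSheaf_res X A)]
    intro U s hs
    refine hloc U.unop.hom s _ hs ?_
    intro V g hg
    exact (Sieve.overEquiv_iff _ _).1 hg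

/-- Reindexing `f^* Q` of a predicate on `Y` along `f : X ⟶ Y`. -/
def reindex (f : X ⟶ Y) (Q : LocalPred Y A) : LocalPred X A :=
  SubSheaf.preimage (isSheaf_res X A) (isSheaf_res Y A)
    (Functor.whiskerLeft (Over.forget A).op f.hom) Q

end LocalPred

/-- The presheaf `A ↦ Pred_{X,0}(A)`. -/
def predPresheaf (X : Sheaf J (Type u)) : Cᵒᵖ ⥤ Type u where
  obj A := LocalPred X A.unop
  map a := ↾fun P => P.over a.unop
  map_id A := by
    apply ConcreteCategory.hom_ext
    intro (P : LocalPred X A.unop)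
    refine LocalPred.ext_holds fun {B} p x => ?_
    change P.Holds (p ≫ 𝟙 _) x ↔ P.Holds p x
    rw [Category.comp_id]
  map_comp {A _ _} f g := by
    apply ConcreteCategory.hom_ext
    intro (P : LocalPred X A.unop)
    refine LocalPred.ext_holds fun {B} p x => ?_
    change P.Holds (p ≫ g.unop ≫ f.unop) x ↔ P.Holds ((p ≫ g.unop) ≫ f.unop) x
    rw [Category.assoc]

theorem LocalPred.existsUnique_glue {X : Sheaf J (Type u)} {A : C} (S : Sieve A) (hS : S ∈ J A)
    (x : ∀ {B : C} (f : B ⟶ A), S f → LocalPred X B)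
    (hx : ∀ {B V : C} (f : B ⟶ A) (hf : S f) (g : V ⟶ B) (hgf : S (g ≫ f)),
      x (g ≫ f) hgf = (x f hf).over g) :
    ∃! P : LocalPred X A, ∀ {B : C} (f : B ⟶ A) (hf : S f), P.over f = x f hf := by
  have key : ∀ {B V W : C} (f : B ⟶ A) (hf : S f) (g : V ⟶ B) (f' : V ⟶ A) (hf' : S f')
      (_ : f' = g ≫ f) (q : W ⟶ V) (y : X.obj.obj (op W)),
      (x f' hf').Holds q y ↔ (x f hf).Holds (q ≫ g) y := by
    rintro B V W f hf g _ hf' rfl q y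
    rw [hx f hf g hf']
    rfl
  have hid : ∀ {V : C} (y : X.obj.obj (op V)), X.obj.map (𝟙 V).op y = y := fun y => by simp
  have hcomp : ∀ {U V W : C} (k : W ⟶ V) (g : V ⟶ U) (y : X.obj.obj (op U)),
      X.obj.map k.op (X.obj.map g.op y) = X.obj.map (k ≫ g).op y := fun k g y => by simp
  let P : LocalPred X A := LocalPred.mk' X A
    (fun {B} p y => ∀ {V : C} (g : V ⟶ B) (h : S (g ≫ p)),
      (x (g ≫ p) h).Holds (𝟙 V) (X.obj.map g.op y))
    (fun {B V} g p y hy W k hk => by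
      have := hy (k ≫ g) (by rwa [Category.assoc])
      have := (key (k ≫ g ≫ p) hk (𝟙 W) _ _ (by simp) _ _).1 this
      rwa [Category.comp_id, ← hcomp] at this)
    (fun {B} p y R hR hy V g hg => by
      refine LocalPred.holds_of_cover _ _ _ (R.pullback g) (J.pullback_stable g hR) ?_
      intro W k hk
      have hk' : S ((k ≫ g) ≫ p) := by
        rw [Category.assoc]; exact S.downward_closed hg k
      have := hy (k ≫ g) hk (𝟙 W) (by rw [Category.id_comp]; exact hk')
      rw [hid] at this
      rw [hcomp, Category.comp_id]
      have := (key (g ≫ p) hg k _ _ (by simp) _ _).1 this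
      rwa [Category.id_comp] at this)
  have hP : ∀ {B V : C} (f : B ⟶ A) (hf : S f) (q : V ⟶ B) (y : X.obj.obj (op V)),
      P.Holds (q ≫ f) y ↔ (x f hf).Holds q y := by
    intro B V f hf q y
    constructor
    · intro h
      have := h (𝟙 V) (S.downward_closed (S.downward_closed hf q) (𝟙 V))
      rw [hid] at this
      have := (key f hf q _ _ (by simp) _ _).1 this
      rwa [Category.id_comp] at this
    · intro h W g hg
      refine (key f hf (g ≫ q) _ _ (by simp) _ _).2 ?_
      rw [Category.id_comp]
      exact h.map g
  refine ⟨P, fun f hf => LocalPred.ext_holds fun q y => hP f hf q y, fun Q hQ => ?_⟩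
  have hQ' : ∀ {B V : C} (f : B ⟶ A) (hf : S f) (q : V ⟶ B) (y : X.obj.obj (op V)),
      Q.Holds (q ≫ f) y ↔ (x f hf).Holds q y := by
    intro B V f hf q y
    rw [← hQ f hf]
    rfl
  have hPQ : ∀ {V : C} (f : V ⟶ A) (_ : S f) (y : X.obj.obj (op V)),
      P.Holds f y ↔ Q.Holds f y := by
    intro V f hf y
    have h1 := hP f hf (𝟙 V) y
    have h2 := hQ' f hf (𝟙 V) y
    rw [Category.id_comp] at h1 h2
    exact h1.trans h2.symm
  refine LocalPred.ext_holds fun {B} q y => ⟨fun h => ?_, fun h => ?_⟩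
  · refine P.holds_of_cover q y (S.pullback q) (J.pullback_stable q hS) fun g hg => ?_
    exact (hPQ _ hg _).2 (h.map g)
  · refine Q.holds_of_cover q y (S.pullback q) (J.pullback_stable q hS) fun g hg => ?_
    exact (hPQ _ hg _).1 (LocalPred.Holds.map (P := P) h g)

theorem isSheaf_predPresheaf (X : Sheaf J (Type u)) : Presheaf.IsSheaf J (predPresheaf X) := by
  rw [isSheaf_iff_isSheaf_of_type]
  intro A S hS x hx
  exact LocalPred.existsUnique_glue S hS (fun {_} f hf => x f hf) fun f hf g _ =>
    (Presieve.compatible_iff_sieveCompatible x).1 hx f g hf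

/-- The object part `Pred_{X,0}`, a sheaf. -/
def predSheaf (X : Sheaf J (Type u)) : Sheaf J (Type u) :=
  ⟨predPresheaf X, isSheaf_predPresheaf X⟩


/-- The presheaf `A ↦ Pred_{X,1}(A)`: pairs `P ≤ Q` of predicates on `X` at stage `A`. -/
def entailPresheaf (X : Sheaf J (Type u)) : Cᵒᵖ ⥤ Type u where
  obj A := {w : LocalPred X A.unop × LocalPred X A.unop // w.1 ≤ w.2}
  map a := ↾fun w => ⟨(w.1.1.over a.unop, w.1.2.over a.unop), fun U => w.2 _⟩
  map_id A := by
    apply ConcreteCategory.hom_ext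
    intro w
    exact Subtype.ext (Prod.ext (ConcreteCategory.congr_hom ((predPresheaf X).map_id A) w.1.1)
      (ConcreteCategory.congr_hom ((predPresheaf X).map_id A) w.1.2))
  map_comp f g := by
    apply ConcreteCategory.hom_ext
    intro w
    exact Subtype.ext (Prod.ext (ConcreteCategory.congr_hom ((predPresheaf X).map_comp f g) w.1.1)
      (ConcreteCategory.congr_hom ((predPresheaf X).map_comp f g) w.1.2))

theorem isSheaf_entailPresheaf (X : Sheaf J (Type u)) :
    Presheaf.IsSheaf J (entailPresheaf X) := by
  rw [isSheaf_iff_isSheaf_of_type]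
  intro A S hS x hx
  have hx' := (Presieve.compatible_iff_sieveCompatible x).1 hx
  obtain ⟨P, hP, hP'⟩ := LocalPred.existsUnique_glue S hS (fun {_} f hf => (x f hf).1.1)
    fun f hf g _ => congrArg (fun w => w.1.1) (hx' f g hf)
  obtain ⟨Q, hQ, hQ'⟩ := LocalPred.existsUnique_glue S hS (fun {_} f hf => (x f hf).1.2)
    fun f hf g _ => congrArg (fun w => w.1.2) (hx' f g hf)
  refine ⟨⟨(P, Q), LocalPred.le_iff.2 fun {B} p y h => ?_⟩, fun B f hf => ?_, fun w hw => ?_⟩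
  · refine Q.holds_of_cover p y (S.pullback p) (J.pullback_stable p hS) fun {V} g hg => ?_
    have h1 : LocalPred.Holds (X := X) (A := V) (P.over (g ≫ p)) (𝟙 V) (X.obj.map g.op y) := by
      change P.Holds (𝟙 V ≫ g ≫ p) _
      rw [Category.id_comp]
      exact h.map g
    rw [hP _ hg] at h1
    have h2 := LocalPred.le_iff.1 (x _ hg).2 _ _ h1
    rw [← hQ _ hg] at h2
    change Q.Holds (𝟙 V ≫ g ≫ p) _ at h2
    rwa [Category.id_comp] at h2
  · exact Subtype.ext (Prod.ext (hP f hf) (hQ f hf))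
  · exact Subtype.ext (Prod.ext
      (hP' _ fun f hf => congrArg (fun w => w.1.1) (hw f hf))
      (hQ' _ fun f hf => congrArg (fun w => w.1.2) (hw f hf)))

/-- The morphism part `Pred_{X,1}`, a sheaf. -/
def entailSheaf (X : Sheaf J (Type u)) : Sheaf J (Type u) :=
  ⟨entailPresheaf X, isSheaf_entailPresheaf X⟩

/-- The source `(P ≤ Q) ↦ P`. -/
def entailSrc (X : Sheaf J (Type u)) : entailSheaf X ⟶ predSheaf X :=
  ObjectProperty.homMk { app A := ↾fun w => w.1.1 }

/-- The target `(P ≤ Q) ↦ Q`. -/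
def entailTgt (X : Sheaf J (Type u)) : entailSheaf X ⟶ predSheaf X :=
  ObjectProperty.homMk { app A := ↾fun w => w.1.2 }

/-- The identities `P ↦ (P ≤ P)`. -/
def entailId (X : Sheaf J (Type u)) : predSheaf X ⟶ entailSheaf X :=
  ObjectProperty.homMk { app A := ↾fun P => ⟨(P, P), le_refl (α := LocalPred X A.unop) P⟩ }

theorem entail_hom_ext {X T : Sheaf J (Type u)} {f g : T ⟶ entailSheaf X}
    (hs : f ≫ entailSrc X = g ≫ entailSrc X) (ht : f ≫ entailTgt X = g ≫ entailTgt X) :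
    f = g := by
  apply Sheaf.hom_ext
  apply NatTrans.ext
  funext A
  apply ConcreteCategory.hom_ext
  intro y
  have h1 : ((f.hom.app A y : (entailPresheaf X).obj A)).1.1 = (g.hom.app A y).1.1 :=
    congrArg (fun k : T ⟶ predSheaf X => k.hom.app A y) hs
  have h2 : ((f.hom.app A y : (entailPresheaf X).obj A)).1.2 = (g.hom.app A y).1.2 :=
    congrArg (fun k : T ⟶ predSheaf X => k.hom.app A y) ht
  exact Subtype.ext (Prod.ext h1 h2)

/-- Composition: `P ≤ Q` and `Q ≤ R` give `P ≤ R`. -/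
noncomputable def entailComp (X : Sheaf J (Type u)) :
    pullback (entailSrc X) (entailTgt X) ⟶ entailSheaf X :=
  ObjectProperty.homMk
    { app A := ↾fun w =>
        ⟨(((pullback.snd (entailSrc X) (entailTgt X)).hom.app A w).1.1,
          ((pullback.fst (entailSrc X) (entailTgt X)).hom.app A w).1.2), by
          have h : ((pullback.fst (entailSrc X) (entailTgt X)).hom.app A w).1.1 =
              ((pullback.snd (entailSrc X) (entailTgt X)).hom.app A w).1.2 :=
            congrArg (fun k : pullback (entailSrc X) (entailTgt X) ⟶ predSheaf X => k.hom.app A w)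
              pullback.condition
          refine le_trans ((pullback.snd (entailSrc X) (entailTgt X)).hom.app A w).2 ?_
          rw [← h]
          exact ((pullback.fst (entailSrc X) (entailTgt X)).hom.app A w).2⟩
      naturality A B a := by
        apply ConcreteCategory.hom_ext
        intro w
        have h1 := congrArg (fun v : (entailPresheaf X).obj B => v.1.1)
          (ConcreteCategory.congr_hom
            ((pullback.snd (entailSrc X) (entailTgt X)).hom.naturality a) w)
        have h2 := congrArg (fun v : (entailPresheaf X).obj B => v.1.2)
          (ConcreteCategory.congr_hom
            ((pullback.fst (entailSrc X) (entailTgt X)).hom.naturality a) w)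
        exact Subtype.ext (Prod.ext h1 h2) }

theorem lift_entailComp_src {X T : Sheaf J (Type u)} (g f : T ⟶ entailSheaf X)
    (h : g ≫ entailSrc X = f ≫ entailTgt X) :
    (pullback.lift g f h ≫ entailComp X) ≫ entailSrc X = f ≫ entailSrc X :=
  (Category.assoc _ _ _).trans (pullback.lift_snd_assoc g f h (entailSrc X))

theorem lift_entailComp_tgt {X T : Sheaf J (Type u)} (g f : T ⟶ entailSheaf X)
    (h : g ≫ entailSrc X = f ≫ entailTgt X) :
    (pullback.lift g f h ≫ entailComp X) ≫ entailTgt X = g ≫ entailTgt X :=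
  (Category.assoc _ _ _).trans (pullback.lift_fst_assoc g f h (entailTgt X))

/-- The fibre `Pred_X` of the predicate fibration over `X`, an internal category in sheaves. -/
noncomputable def predCat (X : Sheaf J (Type u)) : InternalCat (Sheaf J (Type u)) where
  ob := predSheaf X
  mor := entailSheaf X
  s := entailSrc X
  t := entailTgt X
  e := entailId X
  c := entailComp X
  e_s := rfl
  e_t := rfl
  c_s := rfl
  c_t := rfl
  comp_id := entail_hom_ext (lift_entailComp_src _ _ _) (lift_entailComp_tgt _ _ _)
  id_comp := entail_hom_ext (lift_entailComp_src _ _ _) (lift_entailComp_tgt _ _ _)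
  assoc _ _ _ _ _ := entail_hom_ext
    (((lift_entailComp_src _ _ _).trans (lift_entailComp_src _ _ _)).trans
      (lift_entailComp_src _ _ _).symm)
    ((lift_entailComp_tgt _ _ _).trans
      ((lift_entailComp_tgt _ _ _).trans (lift_entailComp_tgt _ _ _)).symm)

section Fibration

/-- A predicate: a sheaf with a subsheaf, that is, with a map to the subobject classifier. -/
structure TotPred {D : Type u} [SmallCategory D] (K : GrothendieckTopology D) where
  carrier : Sheaf K (Type u)
  pred : SubSheaf K carrier.obj

/-- A morphism of sheaves, with its source and target. -/
structure TotHom {D : Type u} [SmallCategory D] (K : GrothendieckTopology D) where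
  src : Sheaf K (Type u)
  tgt : Sheaf K (Type u)
  hom : src ⟶ tgt

/-- A morphism of predicates, with its source and target: a morphism of the underlying sheaves
that maps the first subsheaf into the second. -/
structure TotPredHom {D : Type u} [SmallCategory D] (K : GrothendieckTopology D)
    extends TotHom K where
  dom : SubSheaf K src.obj
  cod : SubSheaf K tgt.obj
  le : ∀ (U : Dᵒᵖ) (x : src.obj.obj U), x ∈ dom.obj U → hom.hom.app U x ∈ cod.obj U

section Restriction

variable {D D' : Type u} [SmallCategory D] [SmallCategory D'] (G : D' ⥤ D)
  (K' : GrothendieckTopology D') {K : GrothendieckTopology D} [G.IsContinuous K' K]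

/-- Restriction of a sheaf along a continuous functor. -/
def resSheaf (S : Sheaf K (Type u)) : Sheaf K' (Type u) :=
  ⟨G.op ⋙ S.obj, G.op_comp_isSheaf K' K S⟩

/-- Restriction of a predicate along a continuous functor. -/
def TotPred.res (w : TotPred K) : TotPred K' where
  carrier := resSheaf G K' w.carrier
  pred := w.pred.res G K'

/-- Restriction of a morphism of sheaves along a continuous functor. -/
def TotHom.res (w : TotHom K) : TotHom K' where
  src := resSheaf G K' w.src
  tgt := resSheaf G K' w.tgt
  hom := ObjectProperty.homMk (Functor.whiskerLeft G.op w.hom.hom)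

/-- Restriction of a morphism of predicates along a continuous functor. -/
def TotPredHom.res (w : TotPredHom K) : TotPredHom K' where
  toTotHom := w.toTotHom.res G K'
  dom := w.dom.res G K'
  cod := w.cod.res G K'
  le U x hx := w.le (G.op.obj U) x hx

theorem resSheaf_congr {G G' : D' ⥤ D} [G.IsContinuous K' K] [G'.IsContinuous K' K] (h : G = G')
    (S : Sheaf K (Type u)) : resSheaf G K' S = resSheaf G' K' S := by
  subst h; rfl

theorem TotPred.res_congr {G G' : D' ⥤ D} [G.IsContinuous K' K] [G'.IsContinuous K' K]
    (h : G = G') (w : TotPred K) : w.res G K' = w.res G' K' := by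
  subst h; rfl

theorem TotHom.res_congr {G G' : D' ⥤ D} [G.IsContinuous K' K] [G'.IsContinuous K' K]
    (h : G = G') (w : TotHom K) : w.res G K' = w.res G' K' := by
  subst h; rfl

theorem TotPredHom.res_congr {G G' : D' ⥤ D} [G.IsContinuous K' K] [G'.IsContinuous K' K]
    (h : G = G') (w : TotPredHom K) : w.res G K' = w.res G' K' := by
  subst h; rfl

end Restriction

instance isContinuous_map_comp {A B B' : C} (f : B' ⟶ B) (g : B ⟶ A) :
    (Over.map f ⋙ Over.map g).IsContinuous (J.over B') (J.over A) :=
  Functor.isContinuous_comp _ _ _ (J.over B) _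

variable (J)

/-- `Univ_0`: at `A`, the small sheaves on `C/A`. -/
def univOb : Cᵒᵖ ⥤ Type (u + 1) where
  obj A := Sheaf (J.over A.unop) (Type u)
  map {_ B} a := ↾fun S => resSheaf (Over.map a.unop) (J.over B.unop) S
  map_id A := by
    apply ConcreteCategory.hom_ext
    exact fun S => resSheaf_congr (J.over A.unop) (Over.mapId_eq A.unop) S
  map_comp {_ _ B} f g := by
    apply ConcreteCategory.hom_ext
    exact fun S => resSheaf_congr (J.over B.unop) (Over.mapComp_eq g.unop f.unop) S

/-- `Univ_1`: at `A`, the morphisms of small sheaves on `C/A`. -/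
def univMor : Cᵒᵖ ⥤ Type (u + 1) where
  obj A := TotHom (J.over A.unop)
  map {_ B} a := ↾fun w => w.res (Over.map a.unop) (J.over B.unop)
  map_id A := by
    apply ConcreteCategory.hom_ext
    exact fun w => w.res_congr (J.over A.unop) (Over.mapId_eq A.unop)
  map_comp {_ _ B} f g := by
    apply ConcreteCategory.hom_ext
    exact fun w => w.res_congr (J.over B.unop) (Over.mapComp_eq g.unop f.unop)

/-- `Pred_0`: at `A`, the predicates on `C/A`. -/
def totOb : Cᵒᵖ ⥤ Type (u + 1) where
  obj A := TotPred (J.over A.unop)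
  map {_ B} a := ↾fun w => w.res (Over.map a.unop) (J.over B.unop)
  map_id A := by
    apply ConcreteCategory.hom_ext
    exact fun w => w.res_congr (J.over A.unop) (Over.mapId_eq A.unop)
  map_comp {_ _ B} f g := by
    apply ConcreteCategory.hom_ext
    exact fun w => w.res_congr (J.over B.unop) (Over.mapComp_eq g.unop f.unop)

/-- `Pred_1`: at `A`, the morphisms of predicates on `C/A`. -/
def totMor : Cᵒᵖ ⥤ Type (u + 1) where
  obj A := TotPredHom (J.over A.unop)
  map {_ B} a := ↾fun w => w.res (Over.map a.unop) (J.over B.unop)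
  map_id A := by
    apply ConcreteCategory.hom_ext
    exact fun w => w.res_congr (J.over A.unop) (Over.mapId_eq A.unop)
  map_comp {_ _ B} f g := by
    apply ConcreteCategory.hom_ext
    exact fun w => w.res_congr (J.over B.unop) (Over.mapComp_eq g.unop f.unop)

/-- The predicate fibration `p : Pred ⟶ Univ` on objects. -/
def fibrationOb : totOb J ⟶ univOb J where
  app _ := ↾fun w => w.carrier

/-- The predicate fibration `p : Pred ⟶ Univ` on morphisms. -/
def fibrationMor : totMor J ⟶ univMor J where
  app _ := ↾fun w => w.toTotHom

variable {J}

/-- The global section of `Univ_0` that internalises the sheaf `X`. -/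
def internalOb (X : Sheaf J (Type u)) :
    (Functor.const Cᵒᵖ).obj (PUnit.{u + 2} : Type (u + 1)) ⟶ univOb J where
  app A := ↾fun _ => resSheaf (Over.forget A.unop) (J.over A.unop) X

/-- The global section of `Univ_1` given by the identity of the internalisation of `X`. -/
def internalId (X : Sheaf J (Type u)) :
    (Functor.const Cᵒᵖ).obj (PUnit.{u + 2} : Type (u + 1)) ⟶ univMor J where
  app A := ↾fun _ => ⟨_, _, 𝟙 (resSheaf (Over.forget A.unop) (J.over A.unop) X)⟩

/-- The inclusion of `Pred_{X,0}` in `Pred_0`. -/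
def fibreOb (X : Sheaf J (Type u)) :
    predPresheaf X ⋙ CategoryTheory.uliftFunctor.{u + 1} ⟶ totOb J where
  app A := ↾fun w => ⟨resSheaf (Over.forget A.unop) (J.over A.unop) X, w.down⟩

/-- The inclusion of `Pred_{X,1}` in `Pred_1`. -/
def fibreMor (X : Sheaf J (Type u)) :
    entailPresheaf X ⋙ CategoryTheory.uliftFunctor.{u + 1} ⟶ totMor J where
  app A := ↾fun w => ⟨⟨_, _, 𝟙 (resSheaf (Over.forget A.unop) (J.over A.unop) X)⟩,
    w.down.1.1, w.down.1.2, fun U x hx => w.down.2 U hx⟩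

/-- The unique map to the terminal presheaf. -/
def toPoint (T : Cᵒᵖ ⥤ Type (u + 1)) :
    T ⟶ (Functor.const Cᵒᵖ).obj (PUnit.{u + 2} : Type (u + 1)) where
  app _ := ↾fun _ => PUnit.unit

/-- `Pred_{X,0}` is the fibre over `X` of the predicate fibration on objects. -/
theorem isPullback_fibreOb (X : Sheaf J (Type u)) :
    IsPullback (fibreOb X) (toPoint _) (fibrationOb J) (internalOb X) := by
  refine IsPullback.of_forall_isPullback_app fun A => ?_
  rw [Types.isPullback_iff]
  refine ⟨rfl, ?_, ?_⟩
  · rintro ⟨P⟩ ⟨Q⟩ ⟨h, -⟩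
    have h' : (⟨resSheaf (Over.forget A.unop) (J.over A.unop) X, P⟩ : TotPred (J.over A.unop)) =
      ⟨resSheaf (Over.forget A.unop) (J.over A.unop) X, Q⟩ := h
    cases h'
    rfl
  · rintro (⟨S, P⟩ : TotPred (J.over A.unop)) ⟨⟩ h
    have h' : S = resSheaf (Over.forget A.unop) (J.over A.unop) X := h
    subst h'
    exact ⟨⟨P⟩, rfl, rfl⟩

/-- `Pred_{X,1}` is the fibre over `X` of the predicate fibration on morphisms. -/
theorem isPullback_fibreMor (X : Sheaf J (Type u)) :
    IsPullback (fibreMor X) (toPoint _) (fibrationMor J) (internalId X) := by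
  refine IsPullback.of_forall_isPullback_app fun A => ?_
  rw [Types.isPullback_iff]
  refine ⟨rfl, ?_, ?_⟩
  · rintro ⟨⟨⟨P, P'⟩, l⟩⟩ ⟨⟨⟨Q, Q'⟩, l'⟩⟩ ⟨h, -⟩
    have h' : (⟨⟨_, _, 𝟙 (resSheaf (Over.forget A.unop) (J.over A.unop) X)⟩, P, P',
        fun U x hx => l U hx⟩ : TotPredHom (J.over A.unop)) =
      ⟨⟨_, _, 𝟙 (resSheaf (Over.forget A.unop) (J.over A.unop) X)⟩, Q, Q',
        fun U x hx => l' U hx⟩ := h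
    cases h'
    rfl
  · rintro (⟨w, P, Q, l⟩ : TotPredHom (J.over A.unop)) ⟨⟩ h
    have h' : w = ⟨_, _, 𝟙 (resSheaf (Over.forget A.unop) (J.over A.unop) X)⟩ := h
    subst h'
    exact ⟨⟨⟨(P, Q), fun U x hx => l U x hx⟩⟩, rfl, rfl⟩

end Fibration

/-- The action on predicates, at stage `A`, of an internal functor `Pred_X ⥤ Pred_Y`. -/
def InternalFunctor.onPred {X Y : Sheaf J (Type u)} (E : InternalFunctor (predCat X) (predCat Y))
    {A : C} (P : LocalPred X A) : LocalPred Y A :=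
  E.onOb.hom.app (op A) P

/-- `E : Pred_X ⥤ Pred_Y` is existential quantification along `f : X ⟶ Y`: at every stage its
object part is left adjoint to reindexing along `f`. -/
def IsExistential {X Y : Sheaf J (Type u)} (f : X ⟶ Y)
    (E : InternalFunctor (predCat X) (predCat Y)) : Prop :=
  ∀ (A : C) (P : LocalPred X A) (Q : LocalPred Y A),
    E.onPred P ≤ Q ↔ P ≤ LocalPred.reindex f Q

section MatchingObject

/-- The matching-object sheaf `M(F)`: at `A`, the matching families of `F` on covers of `A`,
two of them being identified when they agree on a common refinement. -/
noncomputable def matchSheaf (F : Sheaf J (Type u)) : Sheaf J (Type u) :=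
  ⟨J.plusObj F.obj, (Presheaf.isSheaf_of_iso_iff (J.isoToPlus F.obj F.property)).1 F.property⟩

/-- `a : M(F) ⟶ F` sends (the class of) every matching family to its amalgamation. -/
def IsAmalgamation {F : Sheaf J (Type u)} (a : matchSheaf F ⟶ F) : Prop :=
  ∀ (A : C) (S : J.Cover A) (x : Meq F.obj S) (i : S.Arrow),
    F.obj.map i.f.op (a.hom.app (op A) (GrothendieckTopology.Plus.mk x)) = x i

end MatchingObject

section Day

variable [MonoidalCategory C]

/-- Day convolution of presheaves, the left Kan extension of `F ⊠ G` along the tensor product. -/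
noncomputable def dayConv (F G : Cᵒᵖ ⥤ Type u) : Cᵒᵖ ⥤ Type u :=
  (DayFunctor.mk F ⊗ DayFunctor.mk G).functor

/-- The action of Day convolution on natural transformations. -/
noncomputable def dayMap {F F' G G' : Cᵒᵖ ⥤ Type u} (i : F ⟶ F') (j : G ⟶ G') :
    dayConv F G ⟶ dayConv F' G' :=
  DayFunctor.Hom.natTrans (MonoidalCategory.tensorHom
    (X₁ := DayFunctor.mk F) (Y₁ := DayFunctor.mk F') (X₂ := DayFunctor.mk G)
    (Y₂ := DayFunctor.mk G') (DayFunctor.Hom.mk i) (DayFunctor.Hom.mk j))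

/-- The universal map `F(A) × G(B) → (F ⊛ G)(A ⊗ B)`, `(x, y) ↦ x ⊗ y`. -/
noncomputable def pureTensor {F G : Cᵒᵖ ⥤ Type u} {A B : C} (x : F.obj (op A))
    (y : G.obj (op B)) : (dayConv F G).obj (op (A ⊗ B)) :=
  (DayFunctor.η (DayFunctor.mk F) (DayFunctor.mk G)).app (op A, op B) (x, y)

/-- Day-stability of a monoidal site: the Day convolution of sheaves is a sheaf, and it preserves
monomorphisms of sheaves in both arguments. -/
structure IsDayStable (J : GrothendieckTopology C) : Prop where
  isSheaf : ∀ F G : Sheaf J (Type u), Presheaf.IsSheaf J (dayConv F.obj G.obj)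
  mono_left : ∀ {F F' : Sheaf J (Type u)} (i : F ⟶ F') (G : Sheaf J (Type u)) [Mono i],
    Mono (dayMap i.hom (𝟙 G.obj))
  mono_right : ∀ (F : Sheaf J (Type u)) {G G' : Sheaf J (Type u)} (j : G ⟶ G') [Mono j],
    Mono (dayMap (𝟙 F.obj) j.hom)

/-- Day convolution of sheaves on a Day-stable site. -/
noncomputable def IsDayStable.conv (hJ : IsDayStable J) (F G : Sheaf J (Type u)) :
    Sheaf J (Type u) :=
  ⟨dayConv F.obj G.obj, hJ.isSheaf F G⟩

/-- The multiplication of a monoid for Day convolution. -/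
noncomputable def dayMul (hJ : IsDayStable J) (F : Sheaf J (Type u))
    [MonObj (DayFunctor.mk F.obj)] : hJ.conv F F ⟶ F :=
  ObjectProperty.homMk (MonObj.mul (X := DayFunctor.mk F.obj)).natTrans

/-- Natural families of maps `Pred_{F,0}(A) × Pred_{F,0}(B) → Pred_{F ⊛ F,0}(A ⊗ B)`. -/
abbrev PredPairing (hJ : IsDayStable J) (F : Sheaf J (Type u)) : Type u :=
  predPresheaf F ⊠ predPresheaf F ⟶ tensor Cᵒᵖ ⋙ predPresheaf (hJ.conv F F)

/-- The value of a pairing of predicates. -/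
def PredPairing.val {hJ : IsDayStable J} {F : Sheaf J (Type u)} (b : PredPairing hJ F) {A B : C}
    (P : LocalPred F A) (Q : LocalPred F B) : LocalPred (hJ.conv F F) (A ⊗ B) :=
  b.app (op A, op B) (P, Q)

/-- The pairing contains all tensors of elements: if `x` satisfies `P` at `p` and `y` satisfies `Q`
at `q`, then `x ⊗ y` satisfies `b(P, Q)` at `p ⊗ q`. -/
def PredPairing.ContainsTensors {hJ : IsDayStable J} {F : Sheaf J (Type u)}
    (b : PredPairing hJ F) : Prop :=
  ∀ {A B V W : C} (P : LocalPred F A) (Q : LocalPred F B) (p : V ⟶ A) (q : W ⟶ B)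
    (x : F.obj.obj (op V)) (y : F.obj.obj (op W)), P.Holds p x → Q.Holds q y →
    (b.val P Q).Holds (p ⊗ₘ q) (pureTensor x y)

/-- `b` is the image pairing: the least pairing that contains all tensors of elements. -/
def PredPairing.IsImage {hJ : IsDayStable J} {F : Sheaf J (Type u)}
    (b : PredPairing hJ F) : Prop :=
  b.ContainsTensors ∧ ∀ b' : PredPairing hJ F, b'.ContainsTensors →
    ∀ {A B : C} (P : LocalPred F A) (Q : LocalPred F B), b.val P Q ≤ b'.val P Q

/-- `a : Pred_{F,0} ⊛ Pred_{F,0} ⟶ Pred_{F ⊛ F,0}` is induced by the pairing `b` through the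
universal property of the left Kan extension. -/
def IsInducedBy {hJ : IsDayStable J} {F : Sheaf J (Type u)}
    (a : hJ.conv (predSheaf F) (predSheaf F) ⟶ predSheaf (hJ.conv F F))
    (b : PredPairing hJ F) : Prop :=
  ∀ {A B : C} (P : LocalPred F A) (Q : LocalPred F B),
    a.hom.app (op (A ⊗ B)) (pureTensor (F := predPresheaf F) (G := predPresheaf F) P Q) = b.val P Q

/-- `z ∈ (Pred_{F,0} ⊛ Pred_{F,0})(V)` and `w ∈ (F ⊛ F)(V)` are the restrictions, along a common
`f : V ⟶ A ⊗ B`, of `P ⊗ Q` and `x ⊗ y` where `x` satisfies `P` and `y` satisfies `Q`. -/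
def TensorWitness (F : Sheaf J (Type u)) {V : C}
    (z : (dayConv (predPresheaf F) (predPresheaf F)).obj (op V))
    (w : (dayConv F.obj F.obj).obj (op V)) : Prop :=
  ∃ (A B : C) (f : V ⟶ A ⊗ B) (P : LocalPred F A) (Q : LocalPred F B)
    (x : F.obj.obj (op A)) (y : F.obj.obj (op B)), P.Holds (𝟙 A) x ∧ Q.Holds (𝟙 B) y ∧
      (dayConv (predPresheaf F) (predPresheaf F)).map f.op
        (pureTensor (F := predPresheaf F) (G := predPresheaf F) P Q) = z ∧
      (dayConv F.obj F.obj).map f.op (pureTensor x y) = w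

/-- `m : Pred_{F,0} ⊛ Pred_{F,0} ⟶ Pred_{Y,0}` is computed along `h : F ⊛ F ⟶ Y` by the formula:
`y` satisfies `m(z)` at `r` iff, locally, `y` is the image under `h` of some `x ⊗ x'` such that
the restriction of `z` is `P ⊗ Q` with `x` in `P` and `x'` in `Q`. -/
def IsLocalImage (hJ : IsDayStable J) {F Y : Sheaf J (Type u)} (h : hJ.conv F F ⟶ Y)
    (m : hJ.conv (predSheaf F) (predSheaf F) ⟶ predSheaf Y) : Prop :=
  ∀ {Z V : C} (z : (dayConv (predPresheaf F) (predPresheaf F)).obj (op Z)) (r : V ⟶ Z)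
    (y : Y.obj.obj (op V)),
    LocalPred.Holds (X := Y) (A := Z) (m.hom.app (op Z) z) r y ↔
      ∃ S ∈ J V, ∀ {W : C} (g : W ⟶ V), S g →
        ∃ w : (dayConv F.obj F.obj).obj (op W),
          TensorWitness F ((dayConv (predPresheaf F) (predPresheaf F)).map (g ≫ r).op z) w ∧
            h.hom.app (op W) w = Y.obj.map g.op y

end Day

end Sheafeology

open Sheafeology

namespace Sheafeology

variable {C : Type u} [SmallCategory C] {J : GrothendieckTopology C}

/-! Every predicate in the construction is obtained in one way. A family of subsets stable under
restriction is made local by admitting the elements that belong to it on some cover. The resulting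
`LocalPred.closure` is the least predicate containing the family (`LocalPred.closure_le`), so
inequalities out of it need to be checked only on the given subsets.

Applied to the pointwise image along `f`, this yields the left adjoint of reindexing
(`LocalPred.image_le_iff`). The local image commutes with restriction and is monotone. Since
`Pred_X` is a poset at every stage, a monotone map of object sheaves extends to exactly one internal
functor. Left adjoints between posets are unique, so `∃^f` exists and is unique for every `f`. The
map `a` is the inverse of the canonical isomorphism from a sheaf to its plus construction.

The pairing `β` is reached through `α`. The predicate `tensorPred` is the closure of the relation
`TensorWitness`, defined for an arbitrary element `z` of the Day convolution, and it is natural in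
`z`. Restricting it to pure tensors gives `β`, so `α` induces it by construction. For leastness, a
witness for a restriction of `P ⊗ Q` may use different predicates `P'`, `Q'`. A competing pairing
`b` therefore has to be extended to the whole Day convolution by the Kan extension property: the
extension takes one value on the common restriction of `P ⊗ Q` and `P' ⊗ Q'`, which carries
membership from `b(P', Q')` to `b(P, Q)`.

The explicit formula says that the local image of a closure is the closure of the pointwise images.
It holds along every map out of `F ⊛ F`, hence for `⊙'` and, because images compose and `a ∘ ⊙' =
⊙`, for `⋆`. -/

theorem map_map_apply (F : Cᵒᵖ ⥤ Type u) {U V W : C} (k : W ⟶ V) (g : V ⟶ U)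
    (y : F.obj (op U)) : F.map k.op (F.map g.op y) = F.map (k ≫ g).op y := by
  simp

theorem map_id_apply (F : Cᵒᵖ ⥤ Type u) {U : C} (y : F.obj (op U)) :
    F.map (𝟙 U).op y = y := by
  simp

theorem naturality_hom {X Y : Sheaf J (Type u)} (f : X ⟶ Y) {V W : C} (g : W ⟶ V)
    (x : X.obj.obj (op V)) :
    f.hom.app (op W) (X.obj.map g.op x) = Y.obj.map g.op (f.hom.app (op V) x) :=
  NatTrans.naturality_apply f.hom g.op x

/-! ### Local closures and local images of predicates -/

namespace LocalPred

variable {X Y : Sheaf J (Type u)} {A : C}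

/-- The local predicate of the elements that locally belong to a family of subsets. -/
def closure (X : Sheaf J (Type u)) (A : C)
    (H : ∀ {B : C}, (B ⟶ A) → X.obj.obj (op B) → Prop) : LocalPred X A :=
  mk' X A
    (fun {B} p x => ∃ S ∈ J B, ∀ {V : C} (g : V ⟶ B), S g → H (g ≫ p) (X.obj.map g.op x))
    (fun {B V} g p x ⟨S, hS, h⟩ => by
      refine ⟨S.pullback g, J.pullback_stable g hS, fun {W} k hk => ?_⟩
      rw [map_map_apply, ← Category.assoc]
      exact h _ hk)
    (fun {B} p x S hS h => by
      -- Each restriction of `x` along `S` has its own cover on which it lies in `H`; these covers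
      -- are chosen and composed with `S`, so locality is transitivity of the topology.
      refine ⟨Sieve.bind S fun V g hg => (h g hg).choose,
        J.bind_covering hS fun V g hg => (h g hg).choose_spec.1, ?_⟩
      rintro W _ ⟨V, k, g, hg, hk, rfl⟩
      have := (h g hg).choose_spec.2 k hk
      rwa [map_map_apply, ← Category.assoc] at this)

theorem holds_closure_of {H : ∀ {B : C}, (B ⟶ A) → X.obj.obj (op B) → Prop}
    (hmap : ∀ {B V : C} (g : V ⟶ B) (p : B ⟶ A) (x : X.obj.obj (op B)), H p x →
      H (g ≫ p) (X.obj.map g.op x))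
    {B : C} {p : B ⟶ A} {x : X.obj.obj (op B)} (h : H p x) :
    (closure X A H).Holds p x :=
  ⟨⊤, J.top_mem B, fun g _ => hmap g p x h⟩

/-- A predicate is local, so it contains whatever is locally in a family that it contains. This
universal property replaces handling covers in the later comparisons. -/
theorem closure_le {H : ∀ {B : C}, (B ⟶ A) → X.obj.obj (op B) → Prop}
    (hmap : ∀ {B V : C} (g : V ⟶ B) (p : B ⟶ A) (x : X.obj.obj (op B)), H p x →
      H (g ≫ p) (X.obj.map g.op x))
    {Q : LocalPred X A} :
    closure X A H ≤ Q ↔ ∀ {B : C} (p : B ⟶ A) (x : X.obj.obj (op B)), H p x → Q.Holds p x := by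
  refine ⟨fun h B p x hx => le_iff.1 h p x (holds_closure_of hmap hx), fun h => le_iff.2 ?_⟩
  rintro B p x ⟨S, hS, hx⟩
  exact Q.holds_of_cover p x S hS fun g hg => h _ _ (hx g hg)

theorem image_stable (f : X ⟶ Y) (P : LocalPred X A) {B V : C} (g : V ⟶ B) (p : B ⟶ A)
    (y : Y.obj.obj (op B)) (h : ∃ x : X.obj.obj (op B), P.Holds p x ∧ f.hom.app (op B) x = y) :
    ∃ x : X.obj.obj (op V), P.Holds (g ≫ p) x ∧ f.hom.app (op V) x = Y.obj.map g.op y := by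
  obtain ⟨x, hx, rfl⟩ := h
  exact ⟨X.obj.map g.op x, hx.map g, naturality_hom f g x⟩

/-- The local image of a predicate under a morphism of sheaves. -/
def image (f : X ⟶ Y) (P : LocalPred X A) : LocalPred Y A :=
  closure Y A fun {B} p y => ∃ x : X.obj.obj (op B), P.Holds p x ∧ f.hom.app (op B) x = y

/-- By the universal property of the closure only honest images `f(x)` with `x` in `P` matter, and
for these both sides say the same. This is the adjunction that defines existential quantification.
-/
theorem image_le_iff {f : X ⟶ Y} {P : LocalPred X A} {Q : LocalPred Y A} :
    image f P ≤ Q ↔ P ≤ reindex f Q := by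
  refine (closure_le (image_stable f P)).trans
    ⟨fun h => le_iff.2 fun p x hx => h p _ ⟨x, hx, rfl⟩, ?_⟩
  rintro h B p _ ⟨x, hx, rfl⟩
  exact le_iff.1 h p x hx

theorem image_mono {f : X ⟶ Y} {P Q : LocalPred X A} (h : P ≤ Q) : image f P ≤ image f Q :=
  image_le_iff.2 (h.trans (image_le_iff.1 le_rfl))

end LocalPred

/-! ### Internal functors from monotone maps -/

/-- A morphism between sheaves of predicates, at a stage. -/
def onStage {X Y : Sheaf J (Type u)} (φ : predSheaf X ⟶ predSheaf Y) {A : C} (P : LocalPred X A) :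
    LocalPred Y A :=
  φ.hom.app (op A) P

/-- Local images, as a morphism of sheaves of predicates. -/
def imageHom {X Y : Sheaf J (Type u)} (f : X ⟶ Y) : predSheaf X ⟶ predSheaf Y :=
  ObjectProperty.homMk
    { app A := ↾fun P => LocalPred.image (A := A.unop) f P
      naturality A B a := by
        apply ConcreteCategory.hom_ext
        intro (P : LocalPred X A.unop)
        refine LocalPred.ext_holds fun {V} p y => ?_
        -- The image at a stage depends on `P` only through its values at composites into that
        -- stage, so compatibility with restriction (Beck–Chevalley along `a`) reduces to
        -- associativity of composition.
        change (∃ S ∈ J V, ∀ {W : C} (g : W ⟶ V), S g → ∃ x, P.Holds ((g ≫ p) ≫ a.unop) x ∧ _) ↔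
          (∃ S ∈ J V, ∀ {W : C} (g : W ⟶ V), S g → ∃ x, P.Holds (g ≫ p ≫ a.unop) x ∧ _)
        simp only [Category.assoc] }

/-- A stagewise monotone morphism between sheaves of predicates, on entailments. -/
def entailMap {X Y : Sheaf J (Type u)} (φ : predSheaf X ⟶ predSheaf Y)
    (hφ : ∀ (A : C) (P Q : LocalPred X A), P ≤ Q → onStage φ P ≤ onStage φ Q) :
    entailSheaf X ⟶ entailSheaf Y :=
  ObjectProperty.homMk
    { app A := ↾fun w => ⟨(onStage φ w.1.1, onStage φ w.1.2), hφ A.unop _ _ w.2⟩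
      naturality A B a := by
        apply ConcreteCategory.hom_ext
        intro (w : (entailPresheaf X).obj A)
        have h₁ := NatTrans.naturality_apply φ.hom a (show (predPresheaf X).obj A from w.1.1)
        have h₂ := NatTrans.naturality_apply φ.hom a (show (predPresheaf X).obj A from w.1.2)
        exact Subtype.ext (Prod.ext h₁ h₂) }

theorem entailComp_entailSrc (X : Sheaf J (Type u)) :
    entailComp X ≫ entailSrc X = pullback.snd (entailSrc X) (entailTgt X) ≫ entailSrc X :=
  rfl

theorem entailComp_entailTgt (X : Sheaf J (Type u)) :
    entailComp X ≫ entailTgt X = pullback.fst (entailSrc X) (entailTgt X) ≫ entailTgt X :=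
  rfl

section Monotone

variable {X Y : Sheaf J (Type u)} (φ : predSheaf X ⟶ predSheaf Y)
  (hφ : ∀ (A : C) (P Q : LocalPred X A), P ≤ Q → onStage φ P ≤ onStage φ Q)

theorem entailMap_entailSrc : entailMap φ hφ ≫ entailSrc Y = entailSrc X ≫ φ :=
  rfl

theorem entailMap_entailTgt : entailMap φ hφ ≫ entailTgt Y = entailTgt X ≫ φ :=
  rfl

theorem entailId_entailMap : entailId X ≫ entailMap φ hφ = φ ≫ entailId Y :=
  entail_hom_ext rfl rfl

/-- An entailment is determined by its source and target, so preservation of composition has to be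
compared only after these two projections. -/
theorem entailComp_entailMap
    (h : (pullback.fst (entailSrc X) (entailTgt X) ≫ entailMap φ hφ) ≫ entailSrc Y =
      (pullback.snd (entailSrc X) (entailTgt X) ≫ entailMap φ hφ) ≫ entailTgt Y) :
    entailComp X ≫ entailMap φ hφ =
      pullback.lift (pullback.fst (entailSrc X) (entailTgt X) ≫ entailMap φ hφ)
        (pullback.snd (entailSrc X) (entailTgt X) ≫ entailMap φ hφ) h ≫ entailComp Y := by
  apply entail_hom_ext
  · rw [lift_entailComp_src, Category.assoc, Category.assoc, entailMap_entailSrc,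
      ← Category.assoc, ← Category.assoc, entailComp_entailSrc]
  · rw [lift_entailComp_tgt, Category.assoc, Category.assoc, entailMap_entailTgt,
      ← Category.assoc, ← Category.assoc, entailComp_entailTgt]

/-- A stagewise monotone morphism between sheaves of predicates is the object part of an internal
functor. -/
noncomputable def functorOfMonotone : InternalFunctor (predCat X) (predCat Y) where
  onOb := φ
  onMor := entailMap φ hφ
  map_s := entailMap_entailSrc φ hφ
  map_t := entailMap_entailTgt φ hφ
  map_e := entailId_entailMap φ hφ
  map_c := entailComp_entailMap φ hφ _

end Monotone

/-! ### Existence and uniqueness of existential quantification -/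

/-- Source and target are jointly monic on `Pred_{Y,1}`, and both are prescribed on the morphism
part by the object part. -/
theorem internalFunctor_ext {X Y : Sheaf J (Type u)}
    {E E' : InternalFunctor (predCat X) (predCat Y)}
    (h : E.onOb = E'.onOb) : E = E' := by
  have h' : E.onMor = E'.onMor := entail_hom_ext
    (by
      have h₁ : E.onMor ≫ entailSrc Y = entailSrc X ≫ E.onOb := E.map_s
      have h₂ : E'.onMor ≫ entailSrc Y = entailSrc X ≫ E'.onOb := E'.map_s
      exact h₁.trans ((congrArg (entailSrc X ≫ ·) h).trans h₂.symm))
    (by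
      have h₁ : E.onMor ≫ entailTgt Y = entailTgt X ≫ E.onOb := E.map_t
      have h₂ : E'.onMor ≫ entailTgt Y = entailTgt X ≫ E'.onOb := E'.map_t
      exact h₁.trans ((congrArg (entailTgt X ≫ ·) h).trans h₂.symm))
  cases E
  cases E'
  cases h
  cases h'
  rfl

/-- Each of two left adjoints of the same reindexing lies below the other, by the unit of the other
adjunction; antisymmetry identifies the object parts. -/
theorem IsExistential.unique {X Y : Sheaf J (Type u)} {f : X ⟶ Y}
    {E E' : InternalFunctor (predCat X) (predCat Y)} (h : IsExistential f E)
    (h' : IsExistential f E') : E = E' := by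
  refine internalFunctor_ext (Sheaf.hom_ext (NatTrans.ext (funext fun A => ?_)))
  apply ConcreteCategory.hom_ext
  intro (P : LocalPred X A.unop)
  exact le_antisymm (α := LocalPred Y A.unop)
    ((h A.unop P (E'.onPred P)).2 ((h' A.unop P _).1 le_rfl))
    ((h' A.unop P (E.onPred P)).2 ((h A.unop P _).1 le_rfl))

/-- Existential quantification along a morphism of sheaves. -/
noncomputable def existsFunctor {X Y : Sheaf J (Type u)} (f : X ⟶ Y) :
    InternalFunctor (predCat X) (predCat Y) :=
  functorOfMonotone (imageHom f) fun _ _ _ h => LocalPred.image_mono (f := f) h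

theorem isExistential_existsFunctor {X Y : Sheaf J (Type u)} (f : X ⟶ Y) :
    IsExistential f (existsFunctor f) :=
  fun _ _ _ => LocalPred.image_le_iff (f := f)

/-- Both sides are left adjoint to the same map, because preimages compose definitionally. No covers
need to be combined. -/
theorem LocalPred.image_image {X Y Z : Sheaf J (Type u)} (f : X ⟶ Y) (g : Y ⟶ Z) {A : C}
    (P : LocalPred X A) : image g (image f P) = image (f ≫ g) P :=
  eq_of_forall_ge_iff fun Q => by
    rw [image_le_iff, image_le_iff, image_le_iff]
    rfl

theorem imageHom_comp {X Y Z : Sheaf J (Type u)} (f : X ⟶ Y) (g : Y ⟶ Z) :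
    imageHom f ≫ imageHom g = imageHom (f ≫ g) := by
  refine Sheaf.hom_ext (NatTrans.ext (funext fun A => ?_))
  apply ConcreteCategory.hom_ext
  intro (P : LocalPred X A.unop)
  exact LocalPred.image_image f g P

/-! ### Amalgamation of matching families -/

/-- A sheaf is isomorphic to its matching-object sheaf. -/
noncomputable def amalgamationIso (F : Sheaf J (Type u)) : matchSheaf F ≅ F where
  hom := ObjectProperty.homMk (J.isoToPlus F.obj F.property).inv
  inv := ObjectProperty.homMk (J.isoToPlus F.obj F.property).hom
  hom_inv_id := Sheaf.hom_ext (J.isoToPlus F.obj F.property).inv_hom_id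
  inv_hom_id := Sheaf.hom_ext (J.isoToPlus F.obj F.property).hom_inv_id

theorem isAmalgamation_amalgamationIso (F : Sheaf J (Type u)) :
    IsAmalgamation (amalgamationIso F).hom := by
  intro A S x i
  have h₁ := naturality_hom (amalgamationIso F).hom i.f (GrothendieckTopology.Plus.mk x)
  -- Restricted along an arrow `i` of its cover, the class of `x` is the image of `x i` under the
  -- canonical map `F ⟶ M(F)`, which the amalgamation map inverts.
  have h₂ := congrArg ((amalgamationIso F).hom.hom.app _)
    (GrothendieckTopology.Plus.toPlus_apply S x i)
  exact h₁.symm.trans (h₂.symm.trans (ConcreteCategory.congr_hom (congrArg (fun k : F ⟶ F =>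
    k.hom.app (op i.Y)) (amalgamationIso F).inv_hom_id) (x i)))

/-- Every element of the plus construction is represented by a matching family, and separatedness of
`F` leaves at most one amalgamation. -/
theorem IsAmalgamation.unique {F : Sheaf J (Type u)} {a b : matchSheaf F ⟶ F}
    (ha : IsAmalgamation a) (hb : IsAmalgamation b) : a = b := by
  refine Sheaf.hom_ext (NatTrans.ext (funext fun ⟨A⟩ => ?_))
  apply ConcreteCategory.hom_ext
  intro (m : ToType ((J.plusObj F.obj).obj (op A)))
  obtain ⟨S, x, rfl⟩ := GrothendieckTopology.Plus.exists_rep m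
  refine (((isSheaf_iff_isSheaf_of_type _ _).1 F.property).isSeparated _ S.2).ext fun B f hf => ?_
  exact (ha A S x ⟨B, f, hf⟩).trans (hb A S x ⟨B, f, hf⟩).symm

/-! ### Day convolution of predicates and the image pairing -/

section Day

variable [MonoidalCategory C]

theorem map_pureTensor {F G : Cᵒᵖ ⥤ Type u} {A B V W : C} (p : V ⟶ A) (q : W ⟶ B)
    (x : F.obj (op A)) (y : G.obj (op B)) :
    (dayConv F G).map (p ⊗ₘ q).op (pureTensor x y) =
      pureTensor (F.map p.op x) (G.map q.op y) := by
  let t : (F ⊠ G).obj (op A, op B) := (x, y)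
  let k : ((op A, op B) : Cᵒᵖ × Cᵒᵖ) ⟶ (op V, op W) := Prod.mkHom p.op q.op
  exact (NatTrans.naturality_apply (DayFunctor.η (DayFunctor.mk F) (DayFunctor.mk G)) k t).symm

theorem TensorWitness.map {F : Sheaf J (Type u)} {V W : C} (g : W ⟶ V)
    {z : (dayConv (predPresheaf F) (predPresheaf F)).obj (op V)}
    {w : (dayConv F.obj F.obj).obj (op V)} (h : TensorWitness F z w) :
    TensorWitness F ((dayConv (predPresheaf F) (predPresheaf F)).map g.op z)
      ((dayConv F.obj F.obj).map g.op w) := by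
  obtain ⟨A, B, f, P, Q, x, y, hx, hy, rfl, rfl⟩ := h
  exact ⟨A, B, g ≫ f, P, Q, x, y, hx, hy, (map_map_apply _ _ _ _).symm,
    (map_map_apply _ _ _ _).symm⟩

theorem tensorWitness_pureTensor {F : Sheaf J (Type u)} {A B V W : C} {P : LocalPred F A}
    {Q : LocalPred F B} {p : V ⟶ A} {q : W ⟶ B} {x : F.obj.obj (op V)} {y : F.obj.obj (op W)}
    (hx : P.Holds p x) (hy : Q.Holds q y) :
    TensorWitness F ((dayConv (predPresheaf F) (predPresheaf F)).map (p ⊗ₘ q).op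
      (pureTensor (F := predPresheaf F) (G := predPresheaf F) P Q)) (pureTensor x y) := by
  -- The witness lives at stage `V ⊗ W` itself: the predicates are restricted along `p` and `q`,
  -- which turns satisfaction at `p`, `q` into satisfaction at the identities.
  refine ⟨V, W, 𝟙 _, P.over p, Q.over q, x, y, ?_, ?_, ?_, map_id_apply _ _⟩
  · change P.Holds (𝟙 V ≫ p) x
    rwa [Category.id_comp]
  · change Q.Holds (𝟙 W ≫ q) y
    rwa [Category.id_comp]
  · exact (map_id_apply _ _).trans (map_pureTensor (F := predPresheaf F) (G := predPresheaf F)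
      p q P Q).symm

variable (hJ : IsDayStable J) (F : Sheaf J (Type u))

theorem tensorWitness_stable {Z : C} (z : (dayConv (predPresheaf F) (predPresheaf F)).obj (op Z))
    {V W : C} (g : W ⟶ V) (r : V ⟶ Z) (w : (hJ.conv F F).obj.obj (op V))
    (h : TensorWitness F ((dayConv (predPresheaf F) (predPresheaf F)).map r.op z) w) :
    TensorWitness F ((dayConv (predPresheaf F) (predPresheaf F)).map (g ≫ r).op z)
      ((hJ.conv F F).obj.map g.op w) := by
  rw [← map_map_apply]
  exact h.map g

/-- The predicate on `F ⊛ F` given by an element of `Pred_{F,0} ⊛ Pred_{F,0}`: locally, the pair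
is a restriction of some `(P ⊗ Q, x ⊗ y)` with `x` in `P` and `y` in `Q`. -/
noncomputable def tensorPred {Z : C}
    (z : (dayConv (predPresheaf F) (predPresheaf F)).obj (op Z)) : LocalPred (hJ.conv F F) Z :=
  LocalPred.closure (hJ.conv F F) Z fun r w =>
    TensorWitness F ((dayConv (predPresheaf F) (predPresheaf F)).map r.op z) w

theorem holds_tensorPred_of {Z V : C}
    {z : (dayConv (predPresheaf F) (predPresheaf F)).obj (op Z)} {r : V ⟶ Z}
    {w : (dayConv F.obj F.obj).obj (op V)}
    (h : TensorWitness F ((dayConv (predPresheaf F) (predPresheaf F)).map r.op z) w) :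
    (tensorPred hJ F z).Holds r w :=
  LocalPred.holds_closure_of (tensorWitness_stable hJ F z) h

theorem tensorPred_le_iff {Z : C} {z : (dayConv (predPresheaf F) (predPresheaf F)).obj (op Z)}
    {R : LocalPred (hJ.conv F F) Z} :
    tensorPred hJ F z ≤ R ↔ ∀ {V : C} (r : V ⟶ Z) (w : (dayConv F.obj F.obj).obj (op V)),
      TensorWitness F ((dayConv (predPresheaf F) (predPresheaf F)).map r.op z) w →
        R.Holds r w :=
  LocalPred.closure_le (tensorWitness_stable hJ F z)

/-- `tensorPred`, as a morphism of sheaves. -/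
noncomputable def tensorPredHom : hJ.conv (predSheaf F) (predSheaf F) ⟶ predSheaf (hJ.conv F F) :=
  ObjectProperty.homMk
    { app Z := ↾fun z => tensorPred hJ F (Z := Z.unop) z
      naturality Z Z' a := by
        apply ConcreteCategory.hom_ext
        intro (z : (dayConv (predPresheaf F) (predPresheaf F)).obj Z)
        refine LocalPred.ext_holds fun {V} p w => ?_
        change (∃ S ∈ J V, ∀ {W : C} (g : W ⟶ V), S g → TensorWitness F
            ((dayConv (predPresheaf F) (predPresheaf F)).map (g ≫ p).op
              ((dayConv (predPresheaf F) (predPresheaf F)).map a.unop.op z)) _) ↔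
          (∃ S ∈ J V, ∀ {W : C} (g : W ⟶ V), S g → TensorWitness F
            ((dayConv (predPresheaf F) (predPresheaf F)).map (g ≫ p ≫ a.unop).op z) _)
        simp only [map_map_apply, Category.assoc] }

/-- The least pairing of predicates that contains all tensors of elements. -/
noncomputable def imagePairing : PredPairing hJ F :=
  DayFunctor.η (DayFunctor.mk (predPresheaf F)) (DayFunctor.mk (predPresheaf F)) ≫
    Functor.whiskerLeft (tensor Cᵒᵖ) (tensorPredHom hJ F).hom

theorem isInducedBy_tensorPredHom : IsInducedBy (tensorPredHom hJ F) (imagePairing hJ F) :=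
  fun _ _ => rfl

variable {hJ F}

/-- On a Day-stable site the convolution of sheaves is the presheaf convolution, so a map out of it
is determined on pure tensors without sheafification. -/
theorem IsInducedBy.unique {b : PredPairing hJ F}
    {a a' : hJ.conv (predSheaf F) (predSheaf F) ⟶ predSheaf (hJ.conv F F)}
    (h : IsInducedBy a b) (h' : IsInducedBy a' b) : a = a' := by
  let H : DayFunctor Cᵒᵖ (Type u) := DayFunctor.mk (predPresheaf (hJ.conv F F))
  let k : DayFunctor.mk (predPresheaf F) ⊗ DayFunctor.mk (predPresheaf F) ⟶ H :=
    DayFunctor.Hom.mk a.hom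
  let k' : DayFunctor.mk (predPresheaf F) ⊗ DayFunctor.mk (predPresheaf F) ⟶ H :=
    DayFunctor.Hom.mk a'.hom
  have : k = k' := DayFunctor.tensor_hom_ext fun A B => by
    apply ConcreteCategory.hom_ext
    rintro ⟨P, Q⟩
    exact (h (A := A.unop) (B := B.unop) P Q).trans (h' (A := A.unop) (B := B.unop) P Q).symm
  exact Sheaf.hom_ext (congrArg DayFunctor.Hom.natTrans this)

theorem exists_isInducedBy (b : PredPairing hJ F) :
    ∃ a : hJ.conv (predSheaf F) (predSheaf F) ⟶ predSheaf (hJ.conv F F), IsInducedBy a b := by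
  let H : DayFunctor Cᵒᵖ (Type u) := DayFunctor.mk (predPresheaf (hJ.conv F F))
  let k : DayFunctor.mk (predPresheaf F) ⊗ DayFunctor.mk (predPresheaf F) ⟶ H :=
    DayFunctor.tensorDesc b
  refine ⟨ObjectProperty.homMk k.natTrans, fun {A B} P Q => ?_⟩
  let t : (predPresheaf F ⊠ predPresheaf F).obj (op A, op B) := (P, Q)
  exact ConcreteCategory.congr_hom
    (DayFunctor.η_comp_tensorDesc_app (F := DayFunctor.mk (predPresheaf F))
      (G := DayFunctor.mk (predPresheaf F)) (H := H) b (op A) (op B)) t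

theorem val_imagePairing {A B : C} (P : LocalPred F A) (Q : LocalPred F B) :
    (imagePairing hJ F).val P Q =
      tensorPred hJ F (pureTensor (F := predPresheaf F) (G := predPresheaf F) P Q) :=
  rfl

theorem containsTensors_imagePairing : (imagePairing hJ F).ContainsTensors := by
  intro A B V W P Q p q x y hx hy
  rw [val_imagePairing]
  exact holds_tensorPred_of hJ F (tensorWitness_pureTensor hx hy)

/-- Naturality of `a` allows its value at `z` to be computed from any presentation of `z` as a
restricted pure tensor, in particular from the one supplied by the witness. -/
theorem PredPairing.ContainsTensors.holds_of_tensorWitness {b : PredPairing hJ F}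
    (hb : b.ContainsTensors)
    {a : hJ.conv (predSheaf F) (predSheaf F) ⟶ predSheaf (hJ.conv F F)} (h : IsInducedBy a b)
    {V : C} {z : (dayConv (predPresheaf F) (predPresheaf F)).obj (op V)}
    {w : (dayConv F.obj F.obj).obj (op V)} (hw : TensorWitness F z w) :
    LocalPred.Holds (X := hJ.conv F F) (A := V) (a.hom.app (op V) z) (𝟙 V) w := by
  obtain ⟨A, B, f, P, Q, x, y, hx, hy, rfl, rfl⟩ := hw
  have h₁ : a.hom.app (op V) ((dayConv (predPresheaf F) (predPresheaf F)).map f.op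
      (pureTensor (F := predPresheaf F) (G := predPresheaf F) P Q)) =
        (predPresheaf (hJ.conv F F)).map f.op (b.val P Q) :=
    (naturality_hom a f _).trans (congrArg ((predPresheaf (hJ.conv F F)).map f.op) (h P Q))
  rw [h₁]
  change (b.val P Q).Holds (𝟙 V ≫ f) _
  -- Containment of tensors is needed only at the identities, then restricted along `f`.
  have h₂ := (hb P Q (𝟙 A) (𝟙 B) x y hx hy).map f
  rw [id_tensorHom_id, Category.comp_id] at h₂
  rw [Category.id_comp]
  exact h₂

theorem isImage_imagePairing : (imagePairing hJ F).IsImage := by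
  refine ⟨containsTensors_imagePairing, fun b hb A B P Q => ?_⟩
  rw [val_imagePairing]
  rw [tensorPred_le_iff]
  intro V r w hw
  obtain ⟨a, ha⟩ := exists_isInducedBy b
  -- A second computation of the same value, now from the given `P ⊗ Q` and `r` instead of the
  -- predicates in the witness; comparing the two moves `w` into `b(P, Q)` at `r`.
  have h₁ : a.hom.app (op V) ((dayConv (predPresheaf F) (predPresheaf F)).map r.op
      (pureTensor (F := predPresheaf F) (G := predPresheaf F) P Q)) =
        (predPresheaf (hJ.conv F F)).map r.op (b.val P Q) :=
    (naturality_hom a r _).trans (congrArg ((predPresheaf (hJ.conv F F)).map r.op) (ha P Q))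
  have h₂ := hb.holds_of_tensorWitness ha hw
  rw [h₁] at h₂
  change (b.val P Q).Holds (𝟙 V ≫ r) w at h₂
  rwa [Category.id_comp] at h₂

/-- Two nested localisations, one in `tensorPred` and one in the image, collapse to a single cover.
The forward direction uses the universal properties of both closures; the converse keeps the cover,
since a closure contains its generators. -/
theorem isLocalImage_tensorPredHom_comp_imageHom {Y : Sheaf J (Type u)} (h : hJ.conv F F ⟶ Y) :
    IsLocalImage hJ h (tensorPredHom hJ F ≫ imageHom h) := by
  intro Z V z r y
  change (LocalPred.image h (tensorPred hJ F z)).Holds r y ↔ _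
  constructor
  · intro hy
    have hst : ∀ {V W : C} (g : W ⟶ V) (p : V ⟶ Z) (y : Y.obj.obj (op V)),
        (∃ w, TensorWitness F ((dayConv (predPresheaf F) (predPresheaf F)).map p.op z) w ∧
          h.hom.app (op V) w = y) →
        ∃ w, TensorWitness F ((dayConv (predPresheaf F) (predPresheaf F)).map (g ≫ p).op z) w ∧
          h.hom.app (op W) w = Y.obj.map g.op y := by
      rintro V W g p _ ⟨w, hw, rfl⟩
      exact ⟨_, tensorWitness_stable hJ F z g p w hw, naturality_hom h g w⟩
    -- The right side of the formula is itself a predicate, the closure of the images of witnesses,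
    -- so the claim becomes an inequality out of an image.
    suffices h' : LocalPred.image h (tensorPred hJ F z) ≤ LocalPred.closure Y Z fun {V} p y =>
        ∃ w, TensorWitness F ((dayConv (predPresheaf F) (predPresheaf F)).map p.op z) w ∧
          h.hom.app (op V) w = y from LocalPred.le_iff.1 h' r y hy
    rw [LocalPred.image_le_iff, tensorPred_le_iff]
    exact fun p w hw => LocalPred.holds_closure_of hst ⟨w, hw, rfl⟩
  · rintro ⟨S, hS, hy⟩
    refine ⟨S, hS, fun g hg => ?_⟩
    obtain ⟨w, hw, e⟩ := hy g hg
    exact ⟨w, holds_tensorPred_of hJ F hw, e⟩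

end Day

end Sheafeology

/-! ### Assembly of the theorem -/

theorem mainTheorem5 {C : Type u} [SmallCategory C] [MonoidalCategory C]
    (J : GrothendieckTopology C) (hJ : IsDayStable J) (F : Sheaf J (Type u))
    [MonObj (DayFunctor.mk F.obj)] :
    ∃ am : matchSheaf F ≅ F,
      (IsAmalgamation am.hom ∧ ∀ a : matchSheaf F ⟶ F, IsAmalgamation a → a = am.hom) ∧
    ∃ β : PredPairing hJ F, β.IsImage ∧
    ∃ α : hJ.conv (predSheaf F) (predSheaf F) ⟶ predSheaf (hJ.conv F F),
      (IsInducedBy α β ∧ ∀ α', IsInducedBy α' β → α' = α) ∧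
    ∃ E : InternalFunctor (predCat (hJ.conv F F)) (predCat (matchSheaf F)),
      (IsExistential (dayMul hJ F ≫ am.inv) E ∧
        ∀ E', IsExistential (dayMul hJ F ≫ am.inv) E' → E' = E) ∧
    ∃ E₁ : InternalFunctor (predCat (matchSheaf F)) (predCat F),
      (IsExistential am.hom E₁ ∧ ∀ E', IsExistential am.hom E' → E' = E₁) ∧
    ∃ (existsOdot : hJ.conv (predSheaf F) (predSheaf F) ⟶ predSheaf (matchSheaf F))
      (star : hJ.conv (predSheaf F) (predSheaf F) ⟶ predSheaf F),
      existsOdot = α ≫ E.onOb ∧ star = existsOdot ≫ E₁.onOb ∧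
      IsLocalImage hJ (dayMul hJ F ≫ am.inv) existsOdot ∧ IsLocalImage hJ (dayMul hJ F) star := by
  have hmul : dayMul hJ F = (dayMul hJ F ≫ (amalgamationIso F).inv) ≫ (amalgamationIso F).hom := by
    rw [Category.assoc, Iso.inv_hom_id, Category.comp_id]
  refine ⟨amalgamationIso F, ⟨isAmalgamation_amalgamationIso F,
    fun a ha => ha.unique (isAmalgamation_amalgamationIso F)⟩,
    imagePairing hJ F, isImage_imagePairing,
    tensorPredHom hJ F, ⟨isInducedBy_tensorPredHom hJ F,
      fun a ha => ha.unique (isInducedBy_tensorPredHom hJ F)⟩,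
    existsFunctor _, ⟨isExistential_existsFunctor _,
      fun E hE => hE.unique (isExistential_existsFunctor _)⟩,
    existsFunctor _, ⟨isExistential_existsFunctor _,
      fun E hE => hE.unique (isExistential_existsFunctor _)⟩,
    tensorPredHom hJ F ≫ imageHom _, tensorPredHom hJ F ≫ imageHom (dayMul hJ F), rfl, ?_,
    isLocalImage_tensorPredHom_comp_imageHom _, isLocalImage_tensorPredHom_comp_imageHom _⟩
  -- Only the left side is to be factored as `a ∘ ⊙'`, since `⊙` also occurs inside `⊙'` on the
  -- right.
  conv_lhs => rw [hmul, ← imageHom_comp]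
  exact (Category.assoc _ _ _).symm
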